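/- Let $n\ge 1$, $k\ge 0$ and $m=2n+k$. The stable Kneser graph $SG_{n,k}$ has as vertices the $n$-element subsets $S\subset\mathbb Z/m$ with $\{i,i+1\}\not\subset S$ for all $i\in\mathbb Z/m$, two of them being adjacent if and only if they are disjoint. Let $\mathrm{Hom}(K_2,SG_{n,k})$ be the poset of all functions $f$ that assign to each vertex $u\in\{0,1\}$ of $K_2$ a nonempty set $f(u)$ of vertices of $SG_{n,k}$, such that every element of $f(0)$ is adjacent to every element of $f(1)$, ordered by $f\le g$ if and only if $f(u)\subset g(u)$ for all $u$; let $|\mathrm{Hom}(K_2,SG_{n,k})|$ be the geometric realization of its order complex. Let $C_2=\langle\tau\mid\tau^2=1\rangle$ and let $D_{2m}=\langle\sigma,\rho\mid\rho^2=\sigma^m=(\sigma\rho)^2=1\rangle$ be the dihedral group with $2m$ elements. $D_{2m}$ acts from the right on $SG_{n,k}$ by $S\cdot\sigma=\{j+1: j\in S\}$, $S\cdot\rho=\{-j: j\in S\}$, and $\tau$ acts on $K_2$ by exchanging its two vertices. These induce a left $C_2$-action and a right $D_{2m}$-action on $\mathrm{Hom}(K_2,SG_{n,k})$, and hence on its realization.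 Let $W_{n,k}$ be $\mathbb R^{k+1}$ with $\tau\cdot x=-x$ and with the orthogonal right action of $D_{2m}$ given, for $R_\varphi=\begin{pmatrix}\cos\varphi&-\sin\varphi\\ \sin\varphi&\cos\varphi\end{pmatrix}$, by $$x\cdot\sigma=-\operatorname{diag}(1,R_{2\pi/m},R_{4\pi/m},\dots,R_{k\pi/m})\,x,\qquad x\cdot\rho=\operatorname{diag}(1,1,-1,\dots,1,-1)\,x$$ if $k$ is even, and by $$x\cdot\sigma=-\operatorname{diag}(R_{\pi/m},R_{3\pi/m},\dots,R_{k\pi/m})\,x,\qquad x\cdot\rho=\operatorname{diag}(1,-1,\dots,1,-1)\,x$$ if $k$ is odd. Let $S(W_{n,k})$ be its unit sphere. Then there is a continuous map $f\colon S(W_{n,k})\to|\mathrm{Hom}(K_2,SG_{n,k})|$ which is equivariant with respect to the actions of $C_2$ and of $D_{2m}$. -/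

import Mathlib

open scoped RightActions

namespace StableKneser

/-! ### Graphs and Hom posets -/

/-- The Kneser graph `KG_{n,k}` on the `n`-element subsets of `ℤ/(2n+k)`, with disjoint sets
adjacent. (For `n ≥ 1` disjoint `n`-element sets are automatically distinct, so `S ≠ T` is only
needed to have no loop in the degenerate case `n = 0`.) -/
def KG (n k : ℕ) : SimpleGraph {S : Finset (ZMod (2 * n + k)) // S.card = n} where
  Adj S T := S ≠ T ∧ Disjoint S.1 T.1
  symm := ⟨fun _ _ h => ⟨h.1.symm, h.2.symm⟩⟩
  loopless := ⟨fun _ h => h.1 rfl⟩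

/-- The stable subsets of `ℤ/m`: those that contain no pair `i, i + 1`. -/
def IsStable {m : ℕ} (S : Finset (ZMod m)) : Prop :=
  ∀ i : ZMod m, ¬ (i ∈ S ∧ i + 1 ∈ S)

/-- The vertex set of `SG_{n,k}`, as a set of vertices of `KG_{n,k}`. -/
def stableSets (n k : ℕ) : Set {S : Finset (ZMod (2 * n + k)) // S.card = n} :=
  {S | IsStable S.1}

/-- The stable Kneser graph `SG_{n,k}`, an induced subgraph of `KG_{n,k}`. -/
def SG (n k : ℕ) : SimpleGraph (stableSets n k) :=
  (KG n k).induce (stableSets n k)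

/-- The complete graph `K_2`, with vertex set `{0, 1}`. -/
def K2 : SimpleGraph (ZMod 2) := ⊤

/-- The poset `Hom(G, H)`: maps `f` from the vertices of `G` to the nonempty sets of vertices
of `H` such that `f u × f v ⊆ E(H)` for every edge `(u, v)` of `G`. As a subtype of `V → Set W`
it is ordered by `f ≤ g ↔ ∀ u, f u ⊆ g u`. -/
abbrev HomPoset {V W : Type} (G : SimpleGraph V) (H : SimpleGraph W) : Type :=
  {f : V → Set W // (∀ u, (f u).Nonempty) ∧
    ∀ u v, G.Adj u v → ∀ a ∈ f u, ∀ b ∈ f v, H.Adj a b}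

noncomputable instance {V W : Type} [Finite V] [Finite W] (G : SimpleGraph V)
    (H : SimpleGraph W) : Fintype (HomPoset G H) := Fintype.ofFinite _

/-- The functoriality of `Hom`: contravariant in the first, covariant in the second argument. -/
def HomPoset.map {V V' W W' : Type} {G : SimpleGraph V} {G' : SimpleGraph V'}
    {H : SimpleGraph W} {H' : SimpleGraph W'} (φ : G' →g G) (ψ : H →g H')
    (f : HomPoset G H) : HomPoset G' H' :=
  ⟨fun u => ψ '' f.1 (φ u), fun u => (f.2.1 (φ u)).image ψ, by
    rintro u v huv _ ⟨a, ha, rfl⟩ _ ⟨b, hb, rfl⟩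
    exact ψ.map_adj (f.2.2 _ _ (φ.map_adj huv) a ha b hb)⟩

/-! ### The geometric realization of a finite poset -/

/-- The geometric realization `|P|` of (the order complex of) a finite poset `P`, by barycentric
coordinates: the points of the standard simplex on `P` whose support is a chain. The topology is
the subspace topology of `ℝ^P`. -/
def Realization (P : Type) [PartialOrder P] [Fintype P] : Type :=
  {w : P → ℝ // w ∈ stdSimplex ℝ P ∧ IsChain (· ≤ ·) {p | w p ≠ 0}}

instance (P : Type) [PartialOrder P] [Fintype P] : TopologicalSpace (Realization P) :=
  inferInstanceAs (TopologicalSpace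
    {w : P → ℝ // w ∈ stdSimplex ℝ P ∧ IsChain (· ≤ ·) {p | w p ≠ 0}})

/-- A group acting on `P` by order preserving maps acts on `|P|`, moving the vertex `p` to
`γ • p` and extending linearly; in coordinates, `(γ • w) p = w (γ⁻¹ • p)`. -/
instance (Γ P : Type) [Group Γ] [PartialOrder P] [Fintype P] [MulAction Γ P]
    [CovariantClass Γ P (· • ·) (· ≤ ·)] : MulAction Γ (Realization P) where
  smul γ w := ⟨fun p => w.1 (γ⁻¹ • p), ⟨fun p => w.2.1.1 _, by
      rw [← w.2.1.2]
      exact Fintype.sum_equiv (MulAction.toPerm γ⁻¹) _ _ fun _ => rfl⟩, by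
    intro p hp q hq hpq
    have h := w.2.2 hp hq (fun h => hpq (smul_left_cancel _ h))
    have key : ∀ a b : P, γ⁻¹ • a ≤ γ⁻¹ • b → a ≤ b := fun a b hab => by
      simpa using (CovariantClass.elim (μ := (· • ·)) (r := (· ≤ ·)) γ hab : _)
    exact h.imp (key _ _) (key _ _)⟩
  one_smul w := Subtype.ext (funext fun p => by
    change w.1 ((1 : Γ)⁻¹ • p) = w.1 p
    simp)
  mul_smul γ δ w := Subtype.ext (funext fun p => by
    change w.1 ((γ * δ)⁻¹ • p) = w.1 (δ⁻¹ • γ⁻¹ • p)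
    simp [mul_smul])

/-! ### The groups and their actions on `Hom(K_2, SG_{n,k})` -/

/-- The group `C_2`, written multiplicatively. -/
abbrev C2 : Type := Multiplicative (ZMod 2)

/-- The generator of `C_2`. -/
def τ : C2 := Multiplicative.ofAdd 1

/-- The action of `C_2` on `K_2`: the generator `τ` swaps the two vertices. -/
def K2act (c : C2) : K2 →g K2 where
  toFun u := u + c.toAdd
  map_rel' {u v} h := by
    rw [K2, SimpleGraph.top_adj] at h ⊢
    simpa using h

/-- The generator `σ` of the dihedral group `D_{2m}`. -/
def σ {m : ℕ} : DihedralGroup m := DihedralGroup.r 1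

/-- The generator `ρ` of the dihedral group `D_{2m}`. -/
def ρ {m : ℕ} : DihedralGroup m := DihedralGroup.sr 0

theorem ρ_mul_σ_pow {m : ℕ} (i : ℕ) : (ρ : DihedralGroup m) * σ ^ i = DihedralGroup.sr i := by
  simp [ρ, σ]

theorem σ_pow {m : ℕ} (i : ℕ) : (σ : DihedralGroup m) ^ i = DihedralGroup.r i := by
  simp [σ]

/-- The right action of `D_{2m}` on `ℤ/m` with `j · σ = j + 1` and `j · ρ = -j`. -/
def zAct {m : ℕ} (g : DihedralGroup m) (j : ZMod m) : ZMod m :=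
  match g with
  | .r i => j + i
  | .sr i => -j + i

theorem zAct_σ {m : ℕ} (j : ZMod m) : zAct σ j = j + 1 := rfl

theorem zAct_ρ {m : ℕ} (j : ZMod m) : zAct ρ j = -j := by simp [zAct, ρ]

theorem zAct_one {m : ℕ} (j : ZMod m) : zAct 1 j = j := by
  rw [DihedralGroup.one_def]
  exact add_zero j

theorem zAct_mul {m : ℕ} (g h : DihedralGroup m) (j : ZMod m) :
    zAct (g * h) j = zAct h (zAct g j) := by
  rcases g with a | a <;> rcases h with b | b <;>
    simp only [zAct, DihedralGroup.r_mul_r, DihedralGroup.r_mul_sr, DihedralGroup.sr_mul_r,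
      DihedralGroup.sr_mul_sr] <;> ring

theorem zAct_injective {m : ℕ} (g : DihedralGroup m) : Function.Injective (zAct g) := by
  intro a b h
  rcases g with i | i <;> simpa [zAct] using h

theorem isStable_image {m : ℕ} (g : DihedralGroup m) {S : Finset (ZMod m)} (hS : IsStable S) :
    IsStable (S.image (zAct g)) := by
  rintro j ⟨h1, h2⟩
  obtain ⟨a, ha, ha'⟩ := Finset.mem_image.1 h1
  obtain ⟨b, hb, hb'⟩ := Finset.mem_image.1 h2
  rcases g with i | i
  · refine hS a ⟨ha, ?_⟩
    have : b = a + 1 := by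
      simp only [zAct] at ha' hb'
      linear_combination hb' - ha'
    exact this ▸ hb
  · refine hS b ⟨hb, ?_⟩
    have : a = b + 1 := by
      simp only [zAct] at ha' hb'
      linear_combination hb' - ha'
    exact this ▸ ha

/-- The right action of `D_{2m}`, `m = 2n + k`, on `SG_{n,k}`: `S · g = {j · g | j ∈ S}`, so that
`S · σ = {j + 1 | j ∈ S}` and `S · ρ = {-j | j ∈ S}`. -/
def SGact {n k : ℕ} (g : DihedralGroup (2 * n + k)) : SG n k →g SG n k where
  toFun S := ⟨⟨S.1.1.image (zAct g), by
    rw [Finset.card_image_of_injective _ (zAct_injective g), S.1.2]⟩, isStable_image g S.2⟩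
  map_rel' {S T} h := by
    obtain ⟨h1, h2⟩ : S.1 ≠ T.1 ∧ Disjoint S.1.1 T.1.1 := h
    refine (⟨fun h => h1 (Subtype.ext ?_), ?_⟩ : _ ∧ _)
    · exact Finset.image_injective (zAct_injective g) (congrArg Subtype.val h)
    · exact (Finset.disjoint_image (zAct_injective g)).2 h2

instance (n k : ℕ) : Finite {S : Finset (ZMod (2 * n + k)) // S.card = n} := by
  rcases Nat.eq_zero_or_pos n with rfl | hn
  · have : Subsingleton {S : Finset (ZMod (2 * 0 + k)) // S.card = 0} :=
      ⟨fun S T => Subtype.ext <| by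
        rw [Finset.card_eq_zero.1 S.2, Finset.card_eq_zero.1 T.2]⟩
    infer_instance
  · have : NeZero (2 * n + k) := ⟨by omega⟩
    infer_instance

/-- The left action of `C_2` on `Hom(K_2, H)` induced by the action on `K_2`:
`(c • f) u = f (u · c)`. -/
instance {W : Type} (H : SimpleGraph W) : MulAction C2 (HomPoset K2 H) where
  smul c f := HomPoset.map (K2act c) SimpleGraph.Hom.id f
  one_smul f := Subtype.ext <| funext fun u => by
    change id '' f.1 (u + (1 : C2).toAdd) = f.1 u
    simp
  mul_smul c d f := Subtype.ext <| funext fun u => by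
    change id '' f.1 (u + (c * d).toAdd) = id '' (id '' f.1 (u + c.toAdd + d.toAdd))
    simp [add_assoc]

instance {W : Type} (H : SimpleGraph W) :
    CovariantClass C2 (HomPoset K2 H) (· • ·) (· ≤ ·) :=
  ⟨fun c _ _ h u => Set.image_mono (h (u + c.toAdd))⟩

/-- The right action of `D_{2m}` on `Hom(G, SG_{n,k})` induced by the right action on `SG_{n,k}`:
`(f · g) u = {S · g | S ∈ f u}`. -/
instance {V : Type} (G : SimpleGraph V) (n k : ℕ) :
    MulAction (DihedralGroup (2 * n + k))ᵐᵒᵖ (HomPoset G (SG n k)) where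
  smul g f := HomPoset.map SimpleGraph.Hom.id (SGact g.unop) f
  one_smul f := Subtype.ext <| funext fun u => by
    change SGact 1 '' f.1 u = f.1 u
    have : ∀ S : stableSets n k, SGact 1 S = S := fun S =>
      Subtype.ext <| Subtype.ext <| by
        change S.1.1.image (zAct 1) = S.1.1
        rw [show zAct (1 : DihedralGroup (2 * n + k)) = id from funext zAct_one, Finset.image_id]
    rw [show (SGact 1 : stableSets n k → stableSets n k) = id from funext this, Set.image_id]
  mul_smul g h f := Subtype.ext <| funext fun u => by
    change SGact (h.unop * g.unop) '' f.1 u = SGact g.unop '' (SGact h.unop '' f.1 u)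
    rw [Set.image_image]
    refine Set.image_congr fun S _ => Subtype.ext <| Subtype.ext ?_
    change S.1.1.image (zAct (h.unop * g.unop)) =
      (S.1.1.image (zAct h.unop)).image (zAct g.unop)
    rw [Finset.image_image]
    exact congrArg (fun F => S.1.1.image F) (funext fun j => zAct_mul _ _ j)

instance {V : Type} (G : SimpleGraph V) (n k : ℕ) :
    CovariantClass (DihedralGroup (2 * n + k))ᵐᵒᵖ (HomPoset G (SG n k)) (· • ·) (· ≤ ·) :=
  ⟨fun _ _ _ h u => Set.image_mono (h u)⟩

/-! ### The orthogonal representation `W_{n,k}` -/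

/-- The universal property of the presentation
`D_{2m} = ⟨σ, ρ | ρ² = σ^m = (σρ)² = 1⟩`. -/
def dihedralLift {m : ℕ} {G : Type} [Group G] (a b : G) (ha : a ^ m = 1) (hb : b ^ 2 = 1)
    (hab : (a * b) ^ 2 = 1) : DihedralGroup m →* G :=
  let φ : ZMod m →+ Additive G :=
    ZMod.lift m ⟨zmultiplesHom (Additive G) (Additive.ofMul a), by
      rw [zmultiplesHom_apply, natCast_zsmul, ← ofMul_pow, ha, ofMul_one]⟩
  have hφ : ∀ z : ℤ, (φ z).toMul = a ^ z := fun z => by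
    simp only [φ, ZMod.lift_coe, zmultiplesHom_apply]
    rfl
  have hconj : ∀ z : ℤ, a ^ z * b = b * a ^ (-z) := by
    have hb' : b⁻¹ = b := by
      rw [inv_eq_iff_mul_eq_one, ← pow_two, hb]
    have h1 : b * a * b⁻¹ = a⁻¹ := by
      rw [hb', eq_comm, inv_eq_iff_mul_eq_one, ← hab, pow_two]
      group
    intro z
    have h2 : b * a ^ z * b⁻¹ = a ^ (-z) := by
      rw [← conj_zpow, h1, inv_zpow, zpow_neg]
    have h3 : b * (b * a ^ z * b⁻¹) = a ^ z * b := by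
      rw [hb', ← mul_assoc, ← mul_assoc, ← pow_two, hb, one_mul]
    rw [← h2, h3]
  MonoidHom.mk' (fun g => match g with
    | .r i => (φ i).toMul
    | .sr i => b * (φ i).toMul) <| by
    have hbb : b * b = 1 := by rw [← pow_two, hb]
    rintro (i | i) (j | j) <;> obtain ⟨i, rfl⟩ := ZMod.intCast_surjective i <;>
      obtain ⟨j, rfl⟩ := ZMod.intCast_surjective j
    · simp only [DihedralGroup.r_mul_r, ← Int.cast_add, hφ, zpow_add]
    · simp only [DihedralGroup.r_mul_sr, ← Int.cast_sub, hφ]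
      rw [← mul_assoc, hconj, mul_assoc, ← zpow_add, neg_add_eq_sub]
    · simp only [DihedralGroup.sr_mul_r, ← Int.cast_add, hφ, zpow_add, mul_assoc]
    · simp only [DihedralGroup.sr_mul_sr, ← Int.cast_sub, hφ]
      rw [mul_assoc, ← mul_assoc (a ^ i), hconj, ← mul_assoc, ← mul_assoc, hbb, one_mul,
        ← zpow_add, neg_add_eq_sub]

theorem dihedralLift_σ {m : ℕ} {G : Type} [Group G] (a b : G) (ha : a ^ m = 1) (hb : b ^ 2 = 1)
    (hab : (a * b) ^ 2 = 1) : dihedralLift a b ha hb hab σ = a := by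
  have h : ((1 : ℤ) : ZMod m) = 1 := Int.cast_one
  change ((ZMod.lift m ⟨zmultiplesHom (Additive G) (Additive.ofMul a), _⟩) (1 : ZMod m)).toMul = a
  rw [← h, ZMod.lift_coe]
  simp

theorem dihedralLift_ρ {m : ℕ} {G : Type} [Group G] (a b : G) (ha : a ^ m = 1) (hb : b ^ 2 = 1)
    (hab : (a * b) ^ 2 = 1) : dihedralLift a b ha hb hab ρ = b := by
  change b * ((ZMod.lift m ⟨zmultiplesHom (Additive G) (Additive.ofMul a), _⟩)
    (0 : ZMod m)).toMul = b
  simp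

/-- The multiple of the basic angle by which the block containing the coordinate `a` is rotated:
for even `k` the coordinates are grouped as `0 | 1 2 | 3 4 | …` with multiples `0, 2, 4, …`, for
odd `k` as `0 1 | 2 3 | …` with multiples `1, 3, 5, …`. -/
def freq (k a : ℕ) : ℕ :=
  if Even k then 2 * ((a + 1) / 2) else 2 * (a / 2) + 1

/-- The block diagonal matrix `diag(1, R_{2t}, R_{4t}, …, R_{kt})` for even `k` and
`diag(R_t, R_{3t}, …, R_{kt})` for odd `k`, where `R_φ = [[cos φ, -sin φ], [sin φ, cos φ]]`. -/
noncomputable def rot (k : ℕ) (t : ℝ) : Matrix (Fin (k + 1)) (Fin (k + 1)) ℝ :=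
  Matrix.of fun a b =>
    if freq k a = freq k b then
      if a = b then Real.cos (freq k a * t)
      else if a < b then -Real.sin (freq k a * t)
      else Real.sin (freq k a * t)
    else 0

/-- The signs of the reflection: `1, 1, -1, …, 1, -1` for even `k` and `1, -1, …, 1, -1` for
odd `k`. -/
def reflSign (k a : ℕ) : ℝ :=
  if Even k then (if a = 0 ∨ Odd a then 1 else -1) else (if Even a then 1 else -1)

/-- The diagonal matrix by which `ρ` acts. -/
def refl (k : ℕ) : Matrix (Fin (k + 1)) (Fin (k + 1)) ℝ :=
  Matrix.diagonal fun a => reflSign k a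

/-- The other index of the block of `a` (or `0` for the block of size one). -/
def partner (k a : ℕ) : ℕ :=
  if Even k then (if a = 0 then 0 else if Odd a then a + 1 else a - 1)
  else (if Even a then a + 1 else a - 1)

theorem partner_lt {k a : ℕ} (ha : a < k + 1) : partner k a < k + 1 := by
  unfold partner
  split_ifs <;> grind

theorem freq_eq_iff {k a b : ℕ} : freq k a = freq k b ↔ b = a ∨ b = partner k a := by
  unfold freq partner
  split_ifs <;> grind

theorem freq_partner (k a : ℕ) : freq k (partner k a) = freq k a :=
  (freq_eq_iff.2 (Or.inr rfl)).symm

theorem rot_mul (k : ℕ) (s t : ℝ) : rot k s * rot k t = rot k (s + t) := by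
  ext a b
  rw [Matrix.mul_apply]
  set p : Fin (k + 1) := ⟨partner k a, partner_lt a.2⟩ with hp
  have hfp : freq k p = freq k a := freq_partner k a
  have hsub : ∑ c, rot k s a c * rot k t c b =
      ∑ c ∈ ({a, p} : Finset (Fin (k + 1))), rot k s a c * rot k t c b := by
    symm
    apply Finset.sum_subset (Finset.subset_univ _)
    intro c _ hc
    have : freq k a ≠ freq k c := by
      rw [Ne, freq_eq_iff]
      simp only [Finset.mem_insert, Finset.mem_singleton, Fin.ext_iff, hp] at hc
      exact hc
    simp [rot, this]
  rw [hsub]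
  by_cases hab : freq k a = freq k b
  · have hb : b = a ∨ b = p := by
      rcases freq_eq_iff.1 hab with h | h
      · exact Or.inl (Fin.ext h)
      · exact Or.inr (Fin.ext h)
    by_cases hap : a = p
    · have hb' : b = a := by rcases hb with h | h <;> simp [h, ← hap]
      have h0 : freq k a = 0 := by
        have h1 : (a : ℕ) = partner k a := congrArg Fin.val hap
        revert h1
        unfold partner freq
        split_ifs <;> grind
      rw [← hap]
      simp [rot, hb', h0]
    · rw [Finset.sum_pair hap]
      rcases hb with rfl | rfl
      · rcases lt_or_gt_of_ne hap with h | h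
        · simp [rot, hfp, h, hap, Ne.symm hap, not_lt_of_gt h, mul_add, Real.cos_add]
          ring
        · simp [rot, hfp, h, hap, Ne.symm hap, not_lt_of_gt h, mul_add, Real.cos_add]
          ring
      · rcases lt_or_gt_of_ne hap with h | h
        · simp [rot, hfp, h, hap, mul_add, Real.sin_add]
        · simp [rot, hfp, hap, not_lt_of_gt h, mul_add, Real.sin_add]
          ring
  · have : rot k (s + t) a b = 0 := by simp [rot, hab]
    rw [this]
    apply Finset.sum_eq_zero
    intro c hc
    have hc' : freq k c = freq k a := by
      rcases Finset.mem_insert.1 hc with h | h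
      · rw [h]
      · rw [Finset.mem_singleton.1 h, hfp]
    simp [rot, hc', hab]

theorem rot_zero (k : ℕ) : rot k 0 = 1 := by
  ext a b
  by_cases hab : a = b
  · subst hab
    simp [rot]
  · simp [rot, hab]

theorem rot_transpose (k : ℕ) (t : ℝ) : (rot k t).transpose = rot k (-t) := by
  ext a b
  rw [Matrix.transpose_apply]
  by_cases h : freq k a = freq k b
  · rcases lt_trichotomy a b with h1 | h1 | h1
    · simp [rot, h, h1.ne, h1.ne', h1, not_lt_of_gt h1]
    · simp [rot, h1]
    · simp [rot, h, h1.ne, h1.ne', h1, not_lt_of_gt h1]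
  · simp [rot, h, Ne.symm h]

theorem rot_pow (k : ℕ) (t : ℝ) (j : ℕ) : rot k t ^ j = rot k (j * t) := by
  induction j with
  | zero => simp [rot_zero]
  | succ j ih => rw [pow_succ, ih, rot_mul]; congr 1; push_cast; ring

theorem rot_pi (k : ℕ) : rot k Real.pi = (-1) ^ k := by
  have hcos : ∀ a : ℕ, Real.cos (freq k a * Real.pi) = (-1) ^ k := fun a => by
    rw [Real.cos_nat_mul_pi]
    unfold freq
    split_ifs with h
    · rw [h.neg_one_pow]; simp
    · rw [(Nat.not_even_iff_odd.1 h).neg_one_pow]; simp [pow_succ]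
  have key : ((-1) ^ k : Matrix (Fin (k + 1)) (Fin (k + 1)) ℝ) =
      Matrix.diagonal fun _ => (-1 : ℝ) ^ k := by
    rcases Nat.even_or_odd k with h | h
    · simp [h.neg_one_pow]
    · rw [h.neg_one_pow, h.neg_one_pow, ← Matrix.diagonal_one, Matrix.diagonal_neg]
  rw [key]
  ext a b
  by_cases hab : a = b
  · simp [rot, hab, hcos]
  · simp [rot, hab, Real.sin_nat_mul_pi]

theorem reflSign_sq (k a : ℕ) : reflSign k a * reflSign k a = 1 := by
  unfold reflSign
  split_ifs <;> norm_num

theorem refl_mul_self (k : ℕ) : refl k * refl k = 1 := by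
  simp [refl, reflSign_sq]

theorem reflSign_partner {k a : ℕ} (h : partner k a ≠ a) :
    reflSign k (partner k a) = -reflSign k a := by
  unfold reflSign partner at *
  split_ifs at * <;> grind

theorem refl_conj (k : ℕ) (t : ℝ) : refl k * rot k t * refl k = rot k (-t) := by
  ext a b
  simp only [refl, Matrix.mul_diagonal, Matrix.diagonal_mul]
  by_cases hab : freq k a = freq k b
  · by_cases h : a = b
    · subst h
      rw [mul_right_comm, reflSign_sq]
      simp [rot]
    · have hb : (b : ℕ) = partner k a :=
        (freq_eq_iff.1 hab).resolve_left fun h' => h (Fin.ext h'.symm)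
      have hs : reflSign k b = -reflSign k a := by
        rw [hb]
        exact reflSign_partner fun h' => h (Fin.ext (by rw [hb, h']))
      rw [hs, mul_neg, mul_right_comm, reflSign_sq]
      by_cases h1 : a < b <;> simp [rot, hab, h, h1]
  · simp [rot, hab]

/-- The orthogonal matrix of `x ↦ x · σ` on `W_{n,k}`, with `m = 2n + k`. -/
noncomputable def sigmaMat (n k : ℕ) : Matrix.orthogonalGroup (Fin (k + 1)) ℝ :=
  ⟨-rot k (Real.pi / (2 * n + k : ℕ)), by
    rw [Matrix.mem_orthogonalGroup_iff, Matrix.transpose_neg, rot_transpose, neg_mul_neg, rot_mul,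
      add_neg_cancel, rot_zero]⟩

/-- The orthogonal matrix of `x ↦ x · ρ` on `W_{n,k}`. -/
def rhoMat (k : ℕ) : Matrix.orthogonalGroup (Fin (k + 1)) ℝ :=
  ⟨refl k, by
    rw [Matrix.mem_orthogonalGroup_iff, refl, Matrix.diagonal_transpose]
    exact refl_mul_self k⟩

theorem sigmaMat_pow (n k : ℕ) : sigmaMat n k ^ (2 * n + k) = 1 := by
  apply Subtype.ext
  change (-rot k (Real.pi / (2 * n + k : ℕ))) ^ (2 * n + k) = 1
  rcases Nat.eq_zero_or_pos (2 * n + k) with h | h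
  · rw [h, pow_zero]
  · have h' : ((2 * n + k : ℕ) : ℝ) ≠ 0 := by exact_mod_cast h.ne'
    rw [neg_pow, rot_pow, mul_div_cancel₀ _ h', rot_pi, ← pow_add,
      show 2 * n + k + k = 2 * (n + k) by ring, pow_mul]
    simp

theorem rhoMat_sq (k : ℕ) : rhoMat k ^ 2 = 1 := by
  apply Subtype.ext
  change refl k ^ 2 = 1
  rw [pow_two, refl_mul_self]

theorem rho_mul_sigma_sq (n k : ℕ) : (rhoMat k * sigmaMat n k) ^ 2 = 1 := by
  apply Subtype.ext
  change (refl k * -rot k (Real.pi / (2 * n + k : ℕ))) ^ 2 = 1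
  rw [mul_neg, neg_sq, pow_two, ← mul_assoc, refl_conj, rot_mul, neg_add_cancel, rot_zero]

/-- The matrices of the right action of `D_{2m}` on `W_{n,k}`; since it is a right action, this is
a homomorphism to the opposite of the orthogonal group. -/
noncomputable def rep (n k : ℕ) :
    DihedralGroup (2 * n + k) →* (Matrix.orthogonalGroup (Fin (k + 1)) ℝ)ᵐᵒᵖ :=
  dihedralLift (.op (sigmaMat n k)) (.op (rhoMat k))
    (by rw [← MulOpposite.op_pow, sigmaMat_pow, MulOpposite.op_one])
    (by rw [← MulOpposite.op_pow, rhoMat_sq, MulOpposite.op_one])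
    (by rw [← MulOpposite.op_mul, ← MulOpposite.op_pow, rho_mul_sigma_sq, MulOpposite.op_one])

theorem rep_σ (n k : ℕ) : rep n k σ = .op (sigmaMat n k) := dihedralLift_σ _ _ _ _ _

theorem rep_ρ (n k : ℕ) : rep n k ρ = .op (rhoMat k) := dihedralLift_ρ _ _ _ _ _

/-- The right action of `D_{2m}` on `W_{n,k} = ℝ^{k+1}`. -/
noncomputable def wAct (n k : ℕ) (g : DihedralGroup (2 * n + k))
    (x : EuclideanSpace ℝ (Fin (k + 1))) : EuclideanSpace ℝ (Fin (k + 1)) :=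
  WithLp.toLp 2 ((rep n k g).unop.1.mulVec x.ofLp)

theorem wAct_σ (n k : ℕ) (x : EuclideanSpace ℝ (Fin (k + 1))) :
    wAct n k σ x = -WithLp.toLp 2 ((rot k (Real.pi / (2 * n + k : ℕ))).mulVec x.ofLp) := by
  rw [wAct, rep_σ]
  simp [sigmaMat, Matrix.neg_mulVec]

theorem wAct_ρ (n k : ℕ) (x : EuclideanSpace ℝ (Fin (k + 1))) :
    wAct n k ρ x = WithLp.toLp 2 ((refl k).mulVec x.ofLp) := by
  rw [wAct, rep_ρ]
  rfl

theorem wAct_one (n k : ℕ) (x : EuclideanSpace ℝ (Fin (k + 1))) : wAct n k 1 x = x := by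
  simp [wAct]

theorem wAct_mul (n k : ℕ) (g h : DihedralGroup (2 * n + k))
    (x : EuclideanSpace ℝ (Fin (k + 1))) :
    wAct n k (g * h) x = wAct n k h (wAct n k g x) := by
  simp [wAct, Matrix.mulVec_mulVec]

theorem norm_wAct (n k : ℕ) (g : DihedralGroup (2 * n + k))
    (x : EuclideanSpace ℝ (Fin (k + 1))) : ‖wAct n k g x‖ = ‖x‖ := by
  have hA := (Matrix.mem_orthogonalGroup_iff' _ _).1 (rep n k g).unop.2
  have key : ‖wAct n k g x‖ ^ 2 = ‖x‖ ^ 2 := by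
    rw [EuclideanSpace.real_norm_sq_eq, EuclideanSpace.real_norm_sq_eq]
    have h1 : ∀ v : Fin (k + 1) → ℝ, ∑ i, v i ^ 2 = dotProduct v v := fun v => by
      simp [dotProduct, pow_two]
    rw [h1, h1]
    change dotProduct ((rep n k g).unop.1.mulVec x.ofLp) ((rep n k g).unop.1.mulVec x.ofLp) = _
    rw [Matrix.dotProduct_mulVec, Matrix.vecMul_mulVec, ← Matrix.dotProduct_mulVec]
    simp [hA]
  exact (pow_left_inj₀ (norm_nonneg _) (norm_nonneg _) two_ne_zero).1 key

/-- The unit sphere `S(W_{n,k})`. -/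
def WSphere (_n k : ℕ) : Type := Metric.sphere (0 : EuclideanSpace ℝ (Fin (k + 1))) 1

instance (n k : ℕ) : TopologicalSpace (WSphere n k) :=
  inferInstanceAs (TopologicalSpace (Metric.sphere (0 : EuclideanSpace ℝ (Fin (k + 1))) 1))

/-- The antipodal map of `S(W_{n,k})`. -/
def antipode {n k : ℕ} (x : WSphere n k) : WSphere n k :=
  ⟨-x.1, by
    have h := x.2
    rw [mem_sphere_zero_iff_norm] at h ⊢
    rw [norm_neg, h]⟩

/-- The antipodal action of `C_2` on `S(W_{n,k})`: `τ • x = -x`. -/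
instance (n k : ℕ) : MulAction C2 (WSphere n k) where
  smul c x := if c = 1 then x else antipode x
  one_smul x := if_pos rfl
  mul_smul c d x := by
    have h : ∀ c : C2, c = 1 ∨ c = τ := by decide
    have hτ : τ ≠ 1 := by decide
    have hττ : τ * τ = 1 := by decide
    rcases h c with rfl | rfl <;> rcases h d with rfl | rfl
    · rfl
    · rfl
    · rfl
    · change (if τ * τ = 1 then x else antipode x) = antipode (antipode x)
      rw [if_pos hττ]
      exact Subtype.ext (neg_neg x.1).symm

theorem τ_smul (n k : ℕ) (x : WSphere n k) : (τ • x).1 = -x.1 := rfl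

/-- The right action of `D_{2m}` on `S(W_{n,k})`, restricted from `W_{n,k}`. -/
noncomputable instance (n k : ℕ) : MulAction (DihedralGroup (2 * n + k))ᵐᵒᵖ (WSphere n k) where
  smul g x := ⟨wAct n k g.unop x.1, by
    have := x.2
    rw [mem_sphere_zero_iff_norm] at this ⊢
    rw [norm_wAct, this]⟩
  one_smul x := Subtype.ext (wAct_one n k x.1)
  mul_smul g h x := Subtype.ext (wAct_mul n k h.unop g.unop x.1)

end StableKneser

/-!
The map is read off from the signs of trigonometric polynomials. A point `x` of `W_{n,k}` has
coordinates `a_j(x) = ⟨x · σ⁻ʲ, e⟩`, `j ∈ ℤ/m`, where `e` (`axis`) is fixed by `ρ`. Then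
`a_{j·g}(x · g) = a_j(x)` for all `g ∈ D_{2m}` (`coord_wAct`) and `a_j(-x) = -a_j(x)`. Explicitly,
`a_j(x) = (-1)ʲ p(jπ/m)` (`coord_natCast`), where `p` is a trigonometric polynomial with coefficient
vector `x`; since `exp(ikθ) p(θ)` is a polynomial of degree at most `k` in `exp(2iθ)`, a nonzero
`p` has at most `k` zeros in `[0, π)` (`card_zeros_trigPoly_le`).

For `x ≠ 0` the set of `j` with `a_j(x) > 0` contains a stable `n`-set (`exists_stable_pos`). After
a small perturbation, which makes all vanishing coordinates negative, no coordinate is zero. Two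
cyclically adjacent coordinates of the same sign force a zero of `p` between them, so there are at
most `k` such pairs, hence at least `2n` sign alternations; half of them are drops from positive to
negative, and the places of the drops form a stable set.

By compactness there is `δ > 0` such that on the unit sphere the stable `n`-set can be chosen with
`a_j(x) > δ` (`exists_stable_gt`). For `0 ≤ ε ≤ δ` let `P(x, ε)` be the element of
`Hom(K_2, SG_{n,k})` consisting of all stable `n`-sets on which `a_j(x) > ε`, respectively
`a_j(x) < -ε` (`levelHom`). It decreases as `ε` grows, so for fixed `x` its values form a chain, and
giving `q` the weight `vol {s ∈ [0, 1] | P(x, δs) = q}` defines a point of the realization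
(`timeAverage`). This point depends continuously on `x` by dominated convergence
(`continuous_timeAverage`), and equivariantly since `P` is equivariant in `x`.
-/

namespace StableKneser

open MeasureTheory Filter Topology


/-! ### Maps into a realization from families of chains -/

section LevelMap

theorem measurableSet_fiber_of_antitone {Q : Type} [PartialOrder Q] {c : unitInterval → Q}
    (hc : Antitone c) (q : Q) :
    MeasurableSet {s | c s = q} := by
  refine Set.OrdConnected.measurableSet ⟨fun s hs t ht r hr => ?_⟩
  exact le_antisymm (hs ▸ hc hr.1) (ht ▸ hc hr.2)

variable {Q : Type} [PartialOrder Q] [Fintype Q]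

/-- The point of `|Q|` given by an antitone path of elements of `Q`: the weight of `q` is the
length of the time that the path spends at `q`. -/
noncomputable def timeAverage (c : unitInterval → Q) (hc : Antitone c) : Realization Q :=
  ⟨fun q => volume.real {s | c s = q}, ⟨fun q => measureReal_nonneg, by
    rw [← measureReal_biUnion_finset]
    · have : (⋃ q ∈ (Finset.univ : Finset Q), {s | c s = q}) = Set.univ := by
        ext s; simp
      rw [this, probReal_univ]
    · intro p _ q _ hpq
      exact Set.disjoint_left.2 fun s hs ht => hpq (hs.symm.trans ht)
    · exact fun q _ => measurableSet_fiber_of_antitone hc q⟩, by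
    have hne : ∀ q, volume.real {s | c s = q} ≠ 0 → ∃ s, c s = q := fun q hq => by
      by_contra! h
      exact hq (by simp [h])
    intro p hp q hq _
    obtain ⟨s, rfl⟩ := hne p hp
    obtain ⟨t, rfl⟩ := hne q hq
    exact (le_total t s).imp (fun h => hc h) (fun h => hc h)⟩

theorem timeAverage_smul {Γ : Type} [Group Γ] [MulAction Γ Q]
    [CovariantClass Γ Q (· • ·) (· ≤ ·)] (γ : Γ) {c d : unitInterval → Q} (hc : Antitone c)
    (hd : Antitone d) (h : ∀ s, d s = γ • c s) : timeAverage d hd = γ • timeAverage c hc := by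
  refine Subtype.ext (funext fun q => ?_)
  change volume.real {s | d s = q} = volume.real {s | c s = γ⁻¹ • q}
  simp only [h, eq_inv_smul_iff]

/-- If almost every member of a family of antitone paths is locally constant at each parameter
value, then the time averages depend continuously on the parameter, by dominated convergence. -/
theorem continuous_timeAverage {X : Type} [TopologicalSpace X] [FirstCountableTopology X]
    (c : X → unitInterval → Q) (hc : ∀ x, Antitone (c x))
    (hloc : ∀ x, ∀ᵐ s, ∀ᶠ y in 𝓝 x, c y s = c x s) :
    Continuous fun x => timeAverage (c x) (hc x) := by
  refine Continuous.subtype_mk (continuous_pi fun q => continuous_iff_continuousAt.2 fun x => ?_) _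
  have hint : ∀ y, volume.real {s | c y s = q} =
      ∫ s, {s | c y s = q}.indicator (fun _ => (1 : ℝ)) s := fun y => by
    rw [integral_indicator_const _ (measurableSet_fiber_of_antitone (hc y) q)]
    simp
  simp only [hint]
  refine continuousAt_of_dominated (bound := fun _ => 1) (.of_forall fun y => ?_)
    (.of_forall fun y => .of_forall fun s => ?_) (integrable_const _) ?_
  · exact (stronglyMeasurable_const.indicator
      (measurableSet_fiber_of_antitone (hc y) q)).aestronglyMeasurable
  · by_cases h : c y s = q <;> simp [h]
  · filter_upwards [hloc x] with s hs
    refine continuousAt_const.congr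
      (f := fun _ => {s | c x s = q}.indicator (fun _ => (1 : ℝ)) s) ?_
    filter_upwards [hs] with y hy
    by_cases h : c x s = q <;> simp [hy, h]

end LevelMap


/-! ### Trigonometric polynomials -/

/-- The vector of `W_{n,k}` with entry `1` at the coordinates fixed by `ρ` and `0` elsewhere. -/
noncomputable def axis (k : ℕ) (a : Fin (k + 1)) : ℝ := (1 + reflSign k a) / 2

theorem reflSign_eq_or (k a : ℕ) : reflSign k a = 1 ∨ reflSign k a = -1 :=
  mul_self_eq_one_iff.1 (reflSign_sq k a)

theorem axis_mul_reflSign (k : ℕ) (a : Fin (k + 1)) : axis k a * reflSign k a = axis k a := by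
  rcases reflSign_eq_or k a with h | h <;> simp [axis, h]

theorem partner_lt_of_reflSign {k a : ℕ} (h : reflSign k a = -1) : partner k a < a := by
  unfold reflSign at h
  unfold partner
  split_ifs at * <;> first | (norm_num at h; done) | grind

/-- The trigonometric polynomial with coefficient vector `x`: its value at `θ` is the inner product
of `x` with the rotated vector `rot k θ (axis k)`. -/
noncomputable def trigPoly (k : ℕ) (x : Fin (k + 1) → ℝ) (θ : ℝ) : ℝ :=
  axis k ⬝ᵥ (rot k (-θ)).mulVec x

/-- The phase of the `a`-th basic trigonometric function `Re (phase k a * exp (i * freq k a * θ))`,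
which is a cosine at the coordinates fixed by `ρ` and a sine at the others. -/
noncomputable def phase (k : ℕ) (a : Fin (k + 1)) : ℂ :=
  if reflSign k a = 1 then 1 else -Complex.I

theorem vecMul_axis_rot (k : ℕ) (θ : ℝ) (b : Fin (k + 1)) :
    Matrix.vecMul (axis k) (rot k (-θ)) b =
      (phase k b * Complex.exp (Complex.I * (freq k b * θ : ℝ))).re := by
  have hI : (phase k b * Complex.exp (Complex.I * (freq k b * θ : ℝ))).re =
      if reflSign k b = 1 then Real.cos (freq k b * θ) else Real.sin (freq k b * θ) := by
    rw [mul_comm Complex.I, Complex.exp_mul_I, ← Complex.ofReal_cos, ← Complex.ofReal_sin, phase]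
    split_ifs <;>
      simp [-Complex.ofReal_mul, -Complex.ofReal_cos, -Complex.ofReal_sin]
  rw [hI]
  change ∑ a, axis k a * rot k (-θ) a b = _
  have hfreq : ∀ a : Fin (k + 1), freq k a = freq k b → a ≠ b → (a : ℕ) = partner k b :=
    fun a h hab => (freq_eq_iff.1 h.symm).resolve_left fun h' => hab (Fin.ext h')
  rcases reflSign_eq_or k b with h | h
  · rw [if_pos h, Finset.sum_eq_single b]
    · simp [axis, rot, h]
    · intro a _ hab
      by_cases hf : freq k a = freq k b
      · have ha := hfreq a hf hab
        have : reflSign k a = -1 := by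
          rw [ha, reflSign_partner, h]
          exact fun h' => hab (Fin.ext (ha.trans h'))
        simp [axis, this]
      · simp [rot, hf]
    · simp
  · have hlt := partner_lt_of_reflSign h
    rw [if_neg (by rw [h]; norm_num),
      Finset.sum_eq_single (⟨partner k b, hlt.trans b.2⟩ : Fin (k + 1))]
    · have h1 : (⟨partner k b, hlt.trans b.2⟩ : Fin (k + 1)) < b := hlt
      have h2 : reflSign k (partner k b) = 1 := by
        rw [reflSign_partner hlt.ne, h, neg_neg]
      simp [axis, rot, freq_partner, h1, h1.ne, h2]
    · intro a _ hab
      by_cases hf : freq k a = freq k b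
      · by_cases hb : a = b
        · simp [axis, hb, h]
        · exact (hab (Fin.ext (hfreq a hf hb))).elim
      · simp [rot, hf]
    · simp

theorem trigPoly_eq (k : ℕ) (x : Fin (k + 1) → ℝ) (θ : ℝ) :
    trigPoly k x θ =
      ∑ b, (phase k b * Complex.exp (Complex.I * (freq k b * θ : ℝ))).re * x b := by
  rw [trigPoly, Matrix.dotProduct_mulVec]
  exact Finset.sum_congr rfl fun b _ => by rw [vecMul_axis_rot]

theorem continuous_trigPoly (k : ℕ) (x : Fin (k + 1) → ℝ) : Continuous (trigPoly k x) := by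
  rw [funext (trigPoly_eq k x)]
  fun_prop

theorem freq_le {k : ℕ} (a : Fin (k + 1)) : freq k a ≤ k := by
  have := a.2
  unfold freq
  split_ifs <;> grind

theorem even_freq_add (k a : ℕ) : Even (k + freq k a) := by
  unfold freq
  split_ifs <;> grind

open Polynomial in
/-- The polynomial `Q` of degree at most `k` with
`trigPoly k x θ = exp (-i * k * θ) * Q (exp (2 * i * θ))`. -/
noncomputable def circlePoly (k : ℕ) (x : Fin (k + 1) → ℝ) : ℂ[X] :=
  ∑ b, (C (x b * phase k b / 2) * X ^ ((k + freq k b) / 2) +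
    C (x b * star (phase k b) / 2) * X ^ ((k - freq k b) / 2))

theorem natDegree_circlePoly_le (k : ℕ) (x : Fin (k + 1) → ℝ) :
    (circlePoly k x).natDegree ≤ k := by
  refine Polynomial.natDegree_sum_le_of_forall_le _ _ fun b _ => ?_
  have := freq_le b
  refine Polynomial.natDegree_add_le_of_degree_le ?_ ?_ <;>
    refine (Polynomial.natDegree_C_mul_X_pow_le _ _).trans (by omega)

theorem eval_circlePoly (k : ℕ) (x : Fin (k + 1) → ℝ) (θ : ℝ) :
    (circlePoly k x).eval (Complex.exp (Complex.I * (2 * θ : ℝ))) =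
      Complex.exp (Complex.I * (k * θ : ℝ)) * trigPoly k x θ := by
  rw [trigPoly_eq, Complex.ofReal_sum, Finset.mul_sum, circlePoly, Polynomial.eval_finsetSum]
  refine Finset.sum_congr rfl fun b _ => ?_
  obtain ⟨l, hl⟩ := even_freq_add k b
  have hle := freq_le b
  have h1 : (k + freq k b) / 2 = l := by omega
  have h2 : (k - freq k b) / 2 = l - freq k b := by omega
  have h3 : ((l - freq k b : ℕ) : ℂ) = l - freq k b := Nat.cast_sub (by omega)
  have h4 : (k : ℂ) + freq k b = l + l := by exact_mod_cast hl
  simp only [Polynomial.eval_add, Polynomial.eval_mul, Polynomial.eval_C, Polynomial.eval_pow,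
    Polynomial.eval_X, h1, h2, ← Complex.exp_nat_mul, h3]
  rw [Complex.ofReal_mul _ (x b), Complex.re_eq_add_conj, map_mul, ← Complex.exp_conj, map_mul,
    Complex.conj_I, Complex.conj_ofReal]
  have e1 : (l : ℂ) * (Complex.I * ((2 * θ : ℝ) : ℂ)) =
      Complex.I * ((k * θ : ℝ) : ℂ) + Complex.I * ((freq k b * θ : ℝ) : ℂ) := by
    push_cast
    linear_combination -Complex.I * θ * h4
  have e2 : ((l : ℂ) - freq k b) * (Complex.I * ((2 * θ : ℝ) : ℂ)) =
      Complex.I * ((k * θ : ℝ) : ℂ) + -Complex.I * ((freq k b * θ : ℝ) : ℂ) := by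
    push_cast
    linear_combination -Complex.I * θ * h4
  rw [e1, e2, Complex.exp_add, Complex.exp_add]
  simp only [starRingEnd_apply]
  ring

theorem reflSign_of_freq_eq_zero {k a : ℕ} (h : freq k a = 0) : reflSign k a = 1 := by
  unfold freq at h
  unfold reflSign
  split_ifs at * <;> grind

/-- The coefficient vector `x` can be recovered from `circlePoly k x`. -/
theorem circlePoly_ne_zero {k : ℕ} {x : Fin (k + 1) → ℝ} (hx : x ≠ 0) : circlePoly k x ≠ 0 := by
  contrapose! hx
  funext a
  have hle := freq_le a
  obtain ⟨l, hl⟩ := even_freq_add k a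
  have hphase : star (phase k a) * phase k a = 1 := by
    unfold phase
    split_ifs <;> simp
  -- Only `a` and its partner contribute to this coefficient. Their phases are orthogonal in `ℂ`, so
  -- the real part of the product with the conjugate phase of `a` isolates `x a`.
  have hcoeff := congrArg (fun p => (star (phase k a) * p.coeff ((k + freq k a) / 2)).re) hx
  simp only [circlePoly, Polynomial.finsetSum_coeff, Polynomial.coeff_add,
    Polynomial.coeff_C_mul_X_pow, Finset.mul_sum, Complex.re_sum, Polynomial.coeff_zero, mul_zero,
    Complex.zero_re] at hcoeff
  rw [Finset.sum_eq_single a] at hcoeff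
  · rw [if_pos rfl] at hcoeff
    by_cases h0 : freq k a = 0
    · simp [h0, phase, reflSign_of_freq_eq_zero h0] at hcoeff
      simpa using hcoeff
    · rw [if_neg (by omega), add_zero, mul_div_assoc', mul_left_comm, hphase] at hcoeff
      simpa using hcoeff
  · intro b _ hba
    have hb := freq_le b
    obtain ⟨l', hl'⟩ := even_freq_add k b
    by_cases hf : freq k a = freq k b
    · have hp : (b : ℕ) = partner k a :=
        (freq_eq_iff.1 hf).resolve_left fun h => hba (Fin.ext h)
      have hs : reflSign k b = -reflSign k a := by
        rw [hp]
        exact reflSign_partner fun h => hba (Fin.ext (hp.trans h))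
      have h0 : freq k a ≠ 0 := fun h => by
        have h1 := reflSign_of_freq_eq_zero h
        have h2 := reflSign_of_freq_eq_zero (hf ▸ h)
        rw [hs, h1] at h2
        norm_num at h2
      rw [if_pos (by rw [hf]), if_neg (by omega), add_zero]
      rcases reflSign_eq_or k a with h | h
      · norm_num [phase, hs, h]
      · norm_num [phase, hs, h]
    · rw [if_neg (by omega), if_neg (by omega)]
      simp
  · simp

/-- A nonzero trigonometric polynomial has at most `k` zeros in `[0, π)`. -/
theorem card_zeros_trigPoly_le {k : ℕ} {x : Fin (k + 1) → ℝ} (hx : x ≠ 0) (Z : Finset ℝ)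
    (hZ : ∀ θ ∈ Z, θ ∈ Set.Ico 0 Real.pi ∧ trigPoly k x θ = 0) : Z.card ≤ k := by
  classical
  have hinj : Set.InjOn (fun θ : ℝ => Complex.exp (Complex.I * (2 * θ : ℝ))) Z := by
    intro s hs t ht h
    -- `θ ↦ exp (2 * i * θ)` has period `π`, so it is injective on `[0, π)`.
    obtain ⟨j, hj⟩ := Complex.exp_eq_exp_iff_exists_int.1 h
    have hj' : s = t + j * Real.pi := by
      have := congrArg Complex.im hj
      simp at this
      linarith
    obtain ⟨hs0, hs1⟩ := (hZ s hs).1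
    obtain ⟨ht0, ht1⟩ := (hZ t ht).1
    have hpi := Real.pi_pos
    have h1 : (-1 : ℝ) < j := by nlinarith
    have h2 : (j : ℝ) < 1 := by nlinarith
    have h1' : (-1 : ℤ) < j := by exact_mod_cast h1
    have h2' : j < (1 : ℤ) := by exact_mod_cast h2
    obtain rfl : j = 0 := by omega
    simpa using hj'
  rw [← Finset.card_image_of_injOn hinj]
  refine (Polynomial.card_le_degree_of_subset_roots (p := circlePoly k x) ?_).trans
    (natDegree_circlePoly_le k x)
  intro z hz
  obtain ⟨θ, hθ, rfl⟩ := Finset.mem_image.1 hz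
  rw [Polynomial.mem_roots (circlePoly_ne_zero hx), Polynomial.IsRoot, eval_circlePoly,
    (hZ θ hθ).2]
  simp


/-! ### The coordinate functions on `W_{n,k}` indexed by `ℤ/m` -/

/-- The inner product of `x · σ⁻ʲ` with `axis k`. -/
noncomputable def coord (n k : ℕ) (x : EuclideanSpace ℝ (Fin (k + 1)))
    (j : ZMod (2 * n + k)) : ℝ :=
  axis k ⬝ᵥ (wAct n k (.r (-j)) x).ofLp

theorem dotProduct_axis_wAct_ρ (n k : ℕ) (x : EuclideanSpace ℝ (Fin (k + 1))) :
    axis k ⬝ᵥ (wAct n k ρ x).ofLp = axis k ⬝ᵥ x.ofLp := by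
  rw [wAct_ρ]
  refine Finset.sum_congr rfl fun a _ => ?_
  change axis k a * (refl k).mulVec x.ofLp a = _
  rw [refl, Matrix.mulVec_diagonal, ← mul_assoc, axis_mul_reflSign]

/-- Right multiplication by `σ⁻ʲ` turns the action of `D_{2m}` on the index `j` into the action on
`x`, up to a factor `ρ`, which fixes `axis k`. -/
theorem coord_wAct (n k : ℕ) (g : DihedralGroup (2 * n + k))
    (x : EuclideanSpace ℝ (Fin (k + 1))) (j : ZMod (2 * n + k)) :
    coord n k (wAct n k g x) (zAct g j) = coord n k x j := by
  unfold coord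
  rw [← wAct_mul]
  rcases g with i | i
  · have : DihedralGroup.r i * .r (-zAct (.r i) j) = .r (-j) := by
      rw [DihedralGroup.r_mul_r]
      congr 1
      change i + -(j + i) = -j
      ring
    rw [this]
  · rw [← dotProduct_axis_wAct_ρ n k (wAct n k (.r (-j)) x), ← wAct_mul]
    have : DihedralGroup.sr i * .r (-zAct (.sr i) j) = .r (-j) * ρ := by
      rw [ρ, DihedralGroup.sr_mul_r, DihedralGroup.r_mul_sr]
      congr 1
      change i + -(-j + i) = 0 - -j
      ring
    rw [this]

theorem coord_neg (n k : ℕ) (x : EuclideanSpace ℝ (Fin (k + 1))) (j : ZMod (2 * n + k)) :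
    coord n k (-x) j = -coord n k x j := by
  simp [coord, wAct, Matrix.mulVec_neg]

theorem coord_add (n k : ℕ) (x y : EuclideanSpace ℝ (Fin (k + 1))) (j : ZMod (2 * n + k)) :
    coord n k (x + y) j = coord n k x j + coord n k y j := by
  simp [coord, wAct, Matrix.mulVec_add]

theorem coord_smul (n k : ℕ) (c : ℝ) (x : EuclideanSpace ℝ (Fin (k + 1)))
    (j : ZMod (2 * n + k)) : coord n k (c • x) j = c * coord n k x j := by
  simp [coord, wAct, Matrix.mulVec_smul]

theorem continuous_coord (n k : ℕ) (j : ZMod (2 * n + k)) :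
    Continuous fun x => coord n k x j := by
  unfold coord wAct
  fun_prop

theorem coord_natCast (n k : ℕ) (x : EuclideanSpace ℝ (Fin (k + 1))) (j : ℕ) :
    coord n k x j = (-1) ^ j * trigPoly k x.ofLp (j * (Real.pi / (2 * n + k : ℕ))) := by
  have h : (.r (-(j : ZMod (2 * n + k))) : DihedralGroup (2 * n + k)) = (σ ^ j)⁻¹ := by
    rw [σ_pow]
    rfl
  have hmat : (rep n k (.r (-(j : ZMod (2 * n + k))))).unop.1 =
      (-1 : ℝ) ^ j • rot k (-(j * (Real.pi / (2 * n + k : ℕ)))) := by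
    rw [h, map_inv, map_pow, rep_σ, ← MulOpposite.op_pow, ← MulOpposite.op_inv,
      MulOpposite.unop_op]
    change ((-rot k (Real.pi / (2 * n + k : ℕ))) ^ j).transpose = _
    rw [neg_pow, rot_pow, Matrix.transpose_mul, rot_transpose]
    rcases Nat.even_or_odd j with hj | hj <;> simp [hj.neg_one_pow]
  rw [coord, wAct, hmat, trigPoly, Matrix.smul_mulVec, dotProduct_smul, smul_eq_mul]

/-- At most `k` of the coordinates `coord n k x j` of a nonzero `x` vanish. -/
theorem card_coord_eq_zero_le {n k : ℕ} [NeZero (2 * n + k)]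
    {x : EuclideanSpace ℝ (Fin (k + 1))} (hx : x ≠ 0) :
    (Finset.univ.filter fun j => coord n k x j = 0).card ≤ k := by
  have hm : (0 : ℝ) < (2 * n + k : ℕ) := by exact_mod_cast Nat.pos_of_neZero (2 * n + k)
  have ht : 0 < Real.pi / (2 * n + k : ℕ) := by positivity
  have hinj : Function.Injective
      fun j : ZMod (2 * n + k) => (j.val : ℝ) * (Real.pi / (2 * n + k : ℕ)) := fun i j h =>
    ZMod.val_injective _ (by exact_mod_cast mul_right_cancel₀ ht.ne' h)
  rw [← Finset.card_image_of_injective _ hinj]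
  refine card_zeros_trigPoly_le (x := x.ofLp) (by simpa using hx) _ fun θ hθ => ?_
  obtain ⟨j, hj, rfl⟩ := Finset.mem_image.1 hθ
  refine ⟨⟨by positivity, ?_⟩, ?_⟩
  · have : (j.val : ℝ) < (2 * n + k : ℕ) := by exact_mod_cast j.val_lt
    calc _ < ((2 * n + k : ℕ) : ℝ) * (Real.pi / (2 * n + k : ℕ)) := by gcongr
      _ = Real.pi := by field_simp
  · have := (Finset.mem_filter.1 hj).2
    rw [← ZMod.natCast_zmod_val j, coord_natCast] at this
    simpa using this

/-- The coordinates of a nonzero `x` at cyclically consecutive places have the same strict sign at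
most `k` times: the factor `(-1) ^ j` in `coord_natCast` turns such a pair into a sign change, hence
a zero, of the trigonometric polynomial between the two places. -/
theorem card_coord_mul_pos_le {n k : ℕ} [NeZero (2 * n + k)]
    {x : EuclideanSpace ℝ (Fin (k + 1))} (hx : x ≠ 0) :
    (Finset.univ.filter fun j => 0 < coord n k x j * coord n k x (j + 1)).card ≤ k := by
  classical
  have hm : (0 : ℝ) < (2 * n + k : ℕ) := by exact_mod_cast Nat.pos_of_neZero (2 * n + k)
  set t := Real.pi / (2 * n + k : ℕ) with ht_def
  have ht : 0 < t := by positivity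
  have hzero : ∀ j : ZMod (2 * n + k), ∃ θ, 0 < coord n k x j * coord n k x (j + 1) →
      j.val * t < θ ∧ θ < (j.val + 1) * t ∧ trigPoly k x.ofLp θ = 0 := by
    intro j
    by_cases hj : 0 < coord n k x j * coord n k x (j + 1)
    swap
    · exact ⟨0, fun h => (hj h).elim⟩
    have h1 := coord_natCast n k x j.val
    have h2 := coord_natCast n k x (j.val + 1)
    rw [ZMod.natCast_zmod_val] at h1
    rw [Nat.cast_add, ZMod.natCast_zmod_val, Nat.cast_one, Nat.cast_add, Nat.cast_one,
      ← ht_def] at h2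
    rw [← ht_def] at h1
    have hlt : (j.val : ℝ) * t < (j.val + 1) * t := by nlinarith
    have hneg : trigPoly k x.ofLp (j.val * t) * trigPoly k x.ofLp ((j.val + 1) * t) < 0 := by
      rw [h1, h2, pow_succ] at hj
      have hs : ((-1 : ℝ) ^ j.val) * (-1) ^ j.val = 1 := by
        rw [← mul_pow]; simp
      linear_combination hj - trigPoly k x.ofLp (j.val * t) *
        trigPoly k x.ofLp ((j.val + 1) * t) * hs
    have hc := (continuous_trigPoly k x.ofLp).continuousOn
      (s := Set.Icc (j.val * t) ((j.val + 1) * t))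
    have : (0 : ℝ) ∈ trigPoly k x.ofLp '' Set.Ioo (j.val * t) ((j.val + 1) * t) := by
      rcases mul_neg_iff.1 hneg with ⟨ha, hb⟩ | ⟨ha, hb⟩
      · exact intermediate_value_Ioo' hlt.le hc ⟨hb, ha⟩
      · exact intermediate_value_Ioo hlt.le hc ⟨ha, hb⟩
    obtain ⟨θ, hθ, h0⟩ := this
    exact ⟨θ, fun _ => ⟨hθ.1, hθ.2, h0⟩⟩
  choose θ hθ using hzero
  have hinj : Set.InjOn θ
      (Finset.univ.filter fun j => 0 < coord n k x j * coord n k x (j + 1)) := by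
    intro i hi j hj h
    obtain ⟨hi1, hi2, -⟩ := hθ i (Finset.mem_filter.1 hi).2
    obtain ⟨hj1, hj2, -⟩ := hθ j (Finset.mem_filter.1 hj).2
    have h1 : (i.val : ℝ) < j.val + 1 := lt_of_mul_lt_mul_right (by linarith) ht.le
    have h2 : (j.val : ℝ) < i.val + 1 := lt_of_mul_lt_mul_right (by linarith) ht.le
    have h1' : i.val < j.val + 1 := by exact_mod_cast h1
    have h2' : j.val < i.val + 1 := by exact_mod_cast h2
    exact ZMod.val_injective _ (by omega)
  rw [← Finset.card_image_of_injOn hinj]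
  refine card_zeros_trigPoly_le (x := x.ofLp) (by simpa using hx) _ fun z hz => ?_
  obtain ⟨j, hj, rfl⟩ := Finset.mem_image.1 hz
  obtain ⟨hj1, hj2, h0⟩ := hθ j (Finset.mem_filter.1 hj).2
  refine ⟨⟨?_, ?_⟩, h0⟩
  · exact le_trans (by positivity) hj1.le
  · have : (j.val : ℝ) + 1 ≤ (2 * n + k : ℕ) := by exact_mod_cast j.val_lt
    calc θ j < (j.val + 1) * t := hj2
      _ ≤ ((2 * n + k : ℕ) : ℝ) * t := by gcongr
      _ = Real.pi := by rw [ht_def]; field_simp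

/-- Coordinates at `k + 1` places can be prescribed, since by `card_coord_eq_zero_le` the linear map
that reads them off is injective. -/
theorem exists_coord_eq {n k : ℕ} [NeZero (2 * n + k)] {T : Finset (ZMod (2 * n + k))}
    (hT : T.card = k + 1) (b : ZMod (2 * n + k) → ℝ) :
    ∃ y, ∀ j ∈ T, coord n k y j = b j := by
  let L : EuclideanSpace ℝ (Fin (k + 1)) →ₗ[ℝ] (T → ℝ) :=
    { toFun := fun y j => coord n k y j
      map_add' := fun y z => funext fun j => coord_add n k y z j
      map_smul' := fun c y => funext fun j => coord_smul n k c y j }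
  have hinj : Function.Injective L := by
    rw [← LinearMap.ker_eq_bot, LinearMap.ker_eq_bot']
    intro y hy
    by_contra hne
    have h1 : T ⊆ Finset.univ.filter fun j => coord n k y j = 0 := fun j hj => by
      exact Finset.mem_filter.2 ⟨Finset.mem_univ _, congrFun hy ⟨j, hj⟩⟩
    have := (Finset.card_le_card h1).trans (card_coord_eq_zero_le hne)
    omega
  have hsurj := (LinearMap.injective_iff_surjective_of_finrank_eq_finrank
    (by simp [hT])).1 hinj
  obtain ⟨y, hy⟩ := hsurj fun j => b j
  exact ⟨y, fun j hj => congrFun hy ⟨j, hj⟩⟩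

/-! ### Stable sets of places with positive coordinates -/

/-- In a cyclic sequence without zeros, the places where it drops from positive to negative are as
many as those where it rises from negative to positive. -/
theorem card_drop_eq_card_rise {m : ℕ} [NeZero m] (a : ZMod m → ℝ) (ha : ∀ j, a j ≠ 0) :
    (Finset.univ.filter fun j => 0 < a j ∧ a (j + 1) < 0).card =
      (Finset.univ.filter fun j => a j < 0 ∧ 0 < a (j + 1)).card := by
  classical
  -- Both numbers complement that of the `j` with `a j` and `a (j + 1)` positive: one among all
  -- positive `a j`, the other among all positive `a (j + 1)`.
  have h1 : (Finset.univ.filter fun j => 0 < a j).card =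
      (Finset.univ.filter fun j => 0 < a (j + 1)).card :=
    (Finset.card_equiv (Equiv.addRight (1 : ZMod m)) (by simp)).symm
  have h2 := Finset.card_filter_add_card_filter_not (s := Finset.univ.filter fun j => 0 < a j)
    (fun j => 0 < a (j + 1))
  have h3 := Finset.card_filter_add_card_filter_not
    (s := Finset.univ.filter fun j => 0 < a (j + 1)) (fun j => 0 < a j)
  have hneg : ∀ j, ¬ 0 < a j ↔ a j < 0 := fun j =>
    ⟨fun h => lt_of_le_of_ne (not_lt.1 h) (ha j), fun h => not_lt.2 h.le⟩
  simp only [Finset.filter_filter, hneg] at h2 h3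
  simp only [and_comm (a := a _ < 0), and_comm (b := 0 < a (_ + 1))] at h2 h3 ⊢
  omega

theorem exists_stable_of_coord_ne_zero {n k : ℕ} [NeZero (2 * n + k)]
    {x : EuclideanSpace ℝ (Fin (k + 1))} (hx : x ≠ 0) (h : ∀ j, coord n k x j ≠ 0) :
    ∃ S : Finset (ZMod (2 * n + k)), S.card = n ∧ IsStable S ∧ ∀ j ∈ S, 0 < coord n k x j := by
  classical
  set D := Finset.univ.filter fun j => 0 < coord n k x j ∧ coord n k x (j + 1) < 0 with hD
  have hcard : n ≤ D.card := by
    have h1 := card_drop_eq_card_rise (coord n k x) h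
    rw [← hD] at h1
    have h2 := card_coord_mul_pos_le (n := n) hx
    have hcover : (Finset.univ : Finset (ZMod (2 * n + k))) ⊆
        (D ∪ Finset.univ.filter fun j => coord n k x j < 0 ∧ 0 < coord n k x (j + 1)) ∪
          Finset.univ.filter fun j => 0 < coord n k x j * coord n k x (j + 1) := by
      intro j _
      rcases lt_or_gt_of_ne (h j) with h3 | h3 <;> rcases lt_or_gt_of_ne (h (j + 1)) with h4 | h4
      · simp [mul_pos_of_neg_of_neg h3 h4]
      · simp [h3, h4]
      · simp [hD, h3, h4]
      · simp [mul_pos h3 h4]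
    have h3 := Finset.card_le_card hcover
    have h4 := Finset.card_union_le
      (D ∪ Finset.univ.filter fun j => coord n k x j < 0 ∧ 0 < coord n k x (j + 1))
      (Finset.univ.filter fun j => 0 < coord n k x j * coord n k x (j + 1))
    have h5 := Finset.card_union_le D
      (Finset.univ.filter fun j => coord n k x j < 0 ∧ 0 < coord n k x (j + 1))
    rw [Finset.card_univ, ZMod.card] at h3
    omega
  obtain ⟨S, hSD, hS⟩ := Finset.exists_subset_card_eq hcard
  have hmem : ∀ j ∈ S, 0 < coord n k x j ∧ coord n k x (j + 1) < 0 := fun j hj =>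
    (Finset.mem_filter.1 (hSD hj)).2
  exact ⟨S, hS, fun i hi => lt_asymm (hmem i hi.1).2 (hmem _ hi.2).1, fun j hj => (hmem j hj).1⟩

/-- The positive coordinates of a nonzero `x` support a stable set of size `n`. Coordinates that
vanish are first made negative by a small perturbation. -/
theorem exists_stable_pos {n k : ℕ} (hn : 1 ≤ n) {x : EuclideanSpace ℝ (Fin (k + 1))}
    (hx : x ≠ 0) :
    ∃ S : Finset (ZMod (2 * n + k)), S.card = n ∧ IsStable S ∧ ∀ j ∈ S, 0 < coord n k x j := by
  have : NeZero (2 * n + k) := ⟨by omega⟩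
  obtain ⟨T, hZT, hT⟩ := Finset.exists_superset_card_eq
    (s := Finset.univ.filter fun j => coord n k x j = 0) (n := k + 1)
    ((card_coord_eq_zero_le hx).trans k.le_succ) (by rw [ZMod.card]; omega)
  -- `x + ε • y` has negative coordinates where those of `x` vanish.
  obtain ⟨y, hy⟩ := exists_coord_eq hT fun _ => -1
  have hcoord : ∀ j, Continuous fun ε : ℝ => coord n k (x + ε • y) j := fun j =>
    (continuous_coord n k j).comp (by fun_prop)
  have hev : ∀ᶠ ε : ℝ in 𝓝[>] 0, x + ε • y ≠ 0 ∧ ∀ j,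
      (0 < coord n k x j → 0 < coord n k (x + ε • y) j) ∧
      (coord n k x j ≤ 0 → coord n k (x + ε • y) j < 0) := by
    refine Filter.Eventually.and ?_ (Filter.eventually_all.2 fun j => ?_)
    · have hc : Continuous fun ε : ℝ => x + ε • y := by fun_prop
      exact nhdsWithin_le_nhds (hc.continuousAt.eventually_ne (by simpa using hx))
    · rcases lt_trichotomy (coord n k x j) 0 with h | h | h
      · have := (hcoord j).continuousAt.eventually_lt (continuousAt_const (y := (0 : ℝ)) (x := 0))
          (by simpa using h)
        filter_upwards [nhdsWithin_le_nhds this] with ε hε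
        exact ⟨fun h' => (lt_asymm h h').elim, fun _ => hε⟩
      · filter_upwards [self_mem_nhdsWithin] with ε hε
        have hε' : (0 : ℝ) < ε := hε
        rw [coord_add, coord_smul, hy j (hZT (by simpa using h)), h]
        exact ⟨fun h' => (lt_irrefl _ h').elim, fun _ => by linarith⟩
      · have := (continuousAt_const (y := (0 : ℝ)) (x := 0)).eventually_lt (hcoord j).continuousAt
          (by simpa using h)
        filter_upwards [nhdsWithin_le_nhds this] with ε hε
        exact ⟨fun _ => hε, fun h' => (not_lt.2 h' h).elim⟩
  obtain ⟨ε, hne, hε⟩ := hev.exists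
  obtain ⟨S, hS, hst, hpos⟩ := exists_stable_of_coord_ne_zero hne fun j => by
    rcases lt_or_ge 0 (coord n k x j) with h | h
    · exact ((hε j).1 h).ne'
    · exact ((hε j).2 h).ne
  refine ⟨S, hS, hst, fun j hj => ?_⟩
  by_contra h
  exact lt_asymm (hpos j hj) ((hε j).2 (not_lt.1 h))

/-- By compactness of the sphere, the coordinates in `exists_stable_pos` have a common positive
lower bound. -/
theorem exists_stable_gt {n : ℕ} (hn : 1 ≤ n) (k : ℕ) :
    ∃ δ : ℝ, 0 < δ ∧ ∀ x : WSphere n k, ∃ S : stableSets n k, ∀ j ∈ S.1.1, δ < coord n k x.1 j := by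
  let U : ℕ → Set (EuclideanSpace ℝ (Fin (k + 1))) := fun N =>
    ⋃ S : stableSets n k, ⋂ j ∈ S.1.1, {x | 1 / ((N : ℝ) + 1) < coord n k x j}
  have hU : ∀ N, IsOpen (U N) := fun N => isOpen_iUnion fun S =>
    isOpen_biInter_finset fun j _ => isOpen_lt continuous_const (continuous_coord n k j)
  have hmono : Monotone U := fun M N h => Set.iUnion_mono fun S =>
    Set.iInter₂_mono fun j _ x (hx : 1 / ((M : ℝ) + 1) < coord n k x j) =>
      show 1 / ((N : ℝ) + 1) < coord n k x j from (Nat.one_div_le_one_div h).trans_lt hx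
  have hcover : Metric.sphere (0 : EuclideanSpace ℝ (Fin (k + 1))) 1 ⊆ ⋃ N, U N := by
    intro x hx
    obtain ⟨S, hS, hst, hpos⟩ := exists_stable_pos hn (x := x) (by rintro rfl; simp at hx)
    have hev : ∀ᶠ N : ℕ in atTop, ∀ j ∈ S, 1 / ((N : ℝ) + 1) < coord n k x j :=
      (Filter.eventually_all_finset S).2 fun j hj =>
        tendsto_one_div_add_atTop_nhds_zero_nat.eventually_lt_const (hpos j hj)
    obtain ⟨N, hN⟩ := hev.exists
    exact Set.mem_iUnion.2 ⟨N, Set.mem_iUnion.2 ⟨⟨⟨S, hS⟩, hst⟩, Set.mem_iInter₂.2 hN⟩⟩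
  obtain ⟨N, hN⟩ := (isCompact_sphere _ _).elim_directed_cover U hU hcover hmono.directed_le
  refine ⟨1 / ((N : ℝ) + 1), Nat.one_div_pos_of_nat, fun x => ?_⟩
  obtain ⟨S, hS⟩ := Set.mem_iUnion.1 (hN x.2)
  exact ⟨S, Set.mem_iInter₂.1 hS⟩

/-! ### The equivariant map -/

/-- The sign by which the vertex `u` of `K_2` compares coordinates with a threshold. -/
def vertexSign (u : ZMod 2) : ℝ := if u = 0 then 1 else -1

/-- The element of `Hom(K_2, SG_{n,k})` that assigns to the two vertices of `K_2` the stable sets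
of places at which the coordinates of `x` exceed `ε`, respectively lie below `-ε`. The hypothesis `h` makes
both families nonempty (the second one by way of the antipode of `x`), and `0 ≤ ε` makes members of
different families disjoint. -/
noncomputable def levelHom {n k : ℕ} (hn : 1 ≤ n) (x : WSphere n k) (ε : ℝ) (hε : 0 ≤ ε)
    (h : ∀ y : WSphere n k, ∃ S : stableSets n k, ∀ j ∈ S.1.1, ε < coord n k y.1 j) :
    HomPoset K2 (SG n k) :=
  ⟨fun u => {S | ∀ j ∈ S.1.1, ε < vertexSign u * coord n k x.1 j}, by
    constructor
    · intro u
      by_cases hu : u = 0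
      · obtain ⟨S, hS⟩ := h x
        exact ⟨S, by simpa [vertexSign, hu] using hS⟩
      · obtain ⟨S, hS⟩ := h (antipode x)
        refine ⟨S, fun j hj => ?_⟩
        have := hS j hj
        change ε < coord n k (-x.1) j at this
        rw [coord_neg, ← neg_one_mul] at this
        rwa [vertexSign, if_neg hu]
    · intro u v huv S hS T hT
      have hsign : vertexSign u = -vertexSign v := by
        have : ∀ u v : ZMod 2, u ≠ v → (u = 0 ∧ v ≠ 0) ∨ (u ≠ 0 ∧ v = 0) := by decide
        rcases this u v huv with ⟨h1, h2⟩ | ⟨h1, h2⟩ <;> simp [vertexSign, h1, h2]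
      have hdisj : Disjoint S.1.1 T.1.1 := Finset.disjoint_left.2 fun j h1 h2 => by
        have h3 := hS j h1
        have h4 := hT j h2
        rw [hsign] at h3
        linarith
      refine (⟨fun hST => ?_, hdisj⟩ : S.1 ≠ T.1 ∧ _)
      rw [hST, Finset.disjoint_self_iff_empty, ← Finset.card_eq_zero, T.1.2] at hdisj
      omega⟩

variable {n k : ℕ} {hn : 1 ≤ n} {ε : ℝ} {hε : 0 ≤ ε}
  {h : ∀ y : WSphere n k, ∃ S : stableSets n k, ∀ j ∈ S.1.1, ε < coord n k y.1 j}

theorem mem_levelHom {x : WSphere n k} {u : ZMod 2} {S : stableSets n k} :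
    S ∈ (levelHom hn x ε hε h).1 u ↔ ∀ j ∈ S.1.1, ε < vertexSign u * coord n k x.1 j :=
  Iff.rfl

theorem levelHom_τ_smul (x : WSphere n k) :
    levelHom hn (τ • x) ε hε h = τ • levelHom hn x ε hε h := by
  refine Subtype.ext (funext fun u => Set.ext fun S => ?_)
  change _ ↔ S ∈ id '' (levelHom hn x ε hε h).1 (u + 1)
  rw [Set.image_id, mem_levelHom, mem_levelHom]
  have hsign : vertexSign (u + 1) = -vertexSign u := by
    have : ∀ u : ZMod 2, (u = 0 ∧ u + 1 ≠ 0) ∨ (u ≠ 0 ∧ u + 1 = 0) := by decide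
    rcases this u with ⟨h1, h2⟩ | ⟨h1, h2⟩ <;> simp only [vertexSign, h1, h2] <;> simp
  simp only [hsign, τ_smul, coord_neg, mul_neg, neg_mul]

theorem levelHom_C2_smul (c : C2) (x : WSphere n k) :
    levelHom hn (c • x) ε hε h = c • levelHom hn x ε hε h := by
  have hc : ∀ c : C2, c = 1 ∨ c = τ := by decide
  rcases hc c with rfl | rfl
  · simp only [one_smul]
  · exact levelHom_τ_smul x

theorem levelHom_dihedral_smul (g : DihedralGroup (2 * n + k)) (x : WSphere n k) :
    levelHom hn (x <• g) ε hε h = levelHom hn x ε hε h <• g := by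
  have hle : ∀ (g : DihedralGroup (2 * n + k)) (x : WSphere n k),
      levelHom hn x ε hε h <• g ≤ levelHom hn (x <• g) ε hε h := by
    rintro g x u _ ⟨S, hS, rfl⟩ j hj
    obtain ⟨i, hi, rfl⟩ := Finset.mem_image.1 hj
    change ε < vertexSign u * coord n k (wAct n k g x.1) (zAct g i)
    rw [coord_wAct]
    exact hS i hi
  -- The reverse inclusion is the same one for `g⁻¹`, moved by `g`.
  refine le_antisymm ?_ (hle g x)
  have hinv : (levelHom hn (x <• g) ε hε h <• g⁻¹) <• g ≤
      levelHom hn ((x <• g) <• g⁻¹) ε hε h <• g := fun u => Set.image_mono (hle g⁻¹ (x <• g) u)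
  simpa only [MulOpposite.op_inv, smul_inv_smul, inv_smul_smul] using hinv

theorem levelHom_anti {x : WSphere n k} {ε' : ℝ} {hε' : 0 ≤ ε'}
    {h' : ∀ y : WSphere n k, ∃ S : stableSets n k, ∀ j ∈ S.1.1, ε' < coord n k y.1 j}
    (hle : ε ≤ ε') : levelHom hn x ε' hε' h' ≤ levelHom hn x ε hε h :=
  fun _ _ hS j hj => hle.trans_lt (hS j hj)

/-- The element `levelHom` is locally constant in `x` as long as no coordinate hits the
threshold. -/
theorem eventually_levelHom_eq [NeZero (2 * n + k)] {x : WSphere n k}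
    (hx : ∀ u j, vertexSign u * coord n k x.1 j ≠ ε) :
    ∀ᶠ y in 𝓝 x, levelHom hn y ε hε h = levelHom hn x ε hε h := by
  have hev : ∀ u j, ∀ᶠ y : WSphere n k in 𝓝 x,
      (ε < vertexSign u * coord n k y.1 j ↔ ε < vertexSign u * coord n k x.1 j) := by
    intro u j
    have hc : Continuous fun y : WSphere n k => vertexSign u * coord n k y.1 j :=
      continuous_const.mul ((continuous_coord n k j).comp continuous_subtype_val)
    rcases lt_or_gt_of_ne (hx u j) with h1 | h1
    · filter_upwards [hc.continuousAt.eventually_lt_const h1] with y hy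
      exact iff_of_false hy.not_gt h1.not_gt
    · filter_upwards [hc.continuousAt.eventually_const_lt h1] with y hy
      exact iff_of_true hy h1
  filter_upwards [Filter.eventually_all.2 fun u => Filter.eventually_all.2 (hev u)] with y hy
  refine Subtype.ext (funext fun u => Set.ext fun S => ?_)
  simp only [mem_levelHom, hy]

instance (n k : ℕ) : FirstCountableTopology (WSphere n k) :=
  inferInstanceAs (FirstCountableTopology
    (Metric.sphere (0 : EuclideanSpace ℝ (Fin (k + 1))) 1))

end StableKneser

open StableKneser MeasureTheory in
theorem mainTheorem3 (n k : ℕ) (hn : 1 ≤ n) :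
    ∃ f : StableKneser.WSphere n k →
        StableKneser.Realization (StableKneser.HomPoset StableKneser.K2 (StableKneser.SG n k)),
      Continuous f ∧
      (∀ (c : StableKneser.C2) (x : StableKneser.WSphere n k), f (c • x) = c • f x) ∧
      (∀ (g : DihedralGroup (2 * n + k)) (x : StableKneser.WSphere n k),
        f (x <• g) = f x <• g) := by
  have : NeZero (2 * n + k) := ⟨by omega⟩
  obtain ⟨δ, hδ, hS⟩ := exists_stable_gt hn k
  have h0 : ∀ s : unitInterval, 0 ≤ δ * s := fun s => mul_nonneg hδ.le s.2.1
  have h : ∀ (s : unitInterval) (y : WSphere n k),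
      ∃ S : stableSets n k, ∀ j ∈ S.1.1, δ * s < coord n k y.1 j := fun s y =>
    (hS y).imp fun S hS j hj => (mul_le_of_le_one_right hδ.le s.2.2).trans_lt (hS j hj)
  let c : WSphere n k → unitInterval → HomPoset K2 (SG n k) := fun x s =>
    levelHom hn x (δ * s) (h0 s) (h s)
  have hc : ∀ x, Antitone (c x) := fun x s t hst =>
    levelHom_anti (mul_le_mul_of_nonneg_left hst hδ.le)
  refine ⟨fun x => timeAverage (c x) (hc x), continuous_timeAverage c hc fun x => ?_,
    fun a x => timeAverage_smul a _ _ fun s => levelHom_C2_smul a x,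
    fun g x => timeAverage_smul (MulOpposite.op g) _ _ fun s => levelHom_dihedral_smul g x⟩
  -- For given `u` and `j` the threshold `δ * s` meets the coordinate for at most one `s`.
  have hae : ∀ᵐ s : unitInterval, ∀ (u : ZMod 2) (j : ZMod (2 * n + k)),
      vertexSign u * coord n k x.1 j ≠ δ * s := by
    refine ae_all_iff.2 fun u => ae_all_iff.2 fun j => ?_
    have hsub : {s : unitInterval | vertexSign u * coord n k x.1 j = δ * s}.Subsingleton := by
      intro s hs t ht
      exact Subtype.ext (mul_left_cancel₀ hδ.ne' (hs.symm.trans ht))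
    exact (ae_iff.2 (by simpa using hsub.measure_zero volume))
  filter_upwards [hae] with s hs
  exact eventually_levelHom_eq hs
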